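/- Let $\mathcal{T}$ be a real-time transducer with a finite set $Q$ of $n$ states, input alphabet $A$, output alphabet $B$, a finite set $E$ of transitions $e\colon p \xrightarrow{a\mid x} q$ with $p,q\in Q$, $a\in A$, $x\in B^*$ (several transitions may have the same origin, label and end), a set $I\subseteq Q$ of initial states and a set $T\subseteq Q$ of final states. Its behaviour is the set of labels $(u,x)\in A^*\times B^*$ of its successful computations. Suppose that $|x|\le L$ for every transition $p\xrightarrow{a\mid x}q$, and that $\mathcal{T}$ is $k$-valued, i.e. for every $u\in A^*$ there are at most $k$ words $x$ with $(u,x)$ in the behaviour of $\mathcal{T}$. Fix a strict partial order $\prec$ on $E$ in which two distinct transitions are comparable if and only if they have the same origin and the same input letter, and a strict total order $\prec$ on $I$ (void if there is a single initial state); together they order lexicographically the computations that start in $I$ and read the same input word. For $N\in\mathbb{N}$ let $\Delta_N$ be the set of the elements of the free group generated by $B$ that are of the form $w$ or $w^{-1}$ with $w\in B^*$, $|w|\le N$. The lag separation covering of $\mathcal{T}$ bounded by $N$ is the real-time transducer with set of states $Q\times\mathcal{P}(\Delta_N)^Q$; with initial states $(p,\mathsf{i}_p)$, $p\in I$, where $(\mathsf{i}_p)_r=\{1\}$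 if $r\in I$ and $r\prec p$, and $(\mathsf{i}_p)_r=\emptyset$ otherwise (so the only initial state is $(i,\vec{\emptyset})$ when $I=\{i\}$); with final states $T\times\mathcal{P}(\Delta_N)^Q$; and, for every state $(p,\mathsf{v})$ and every transition $e\colon p\xrightarrow{a\mid x}q$ of $\mathcal{T}$, with one transition $(p,\mathsf{v})\xrightarrow{a\mid x}(q,\mathsf{v}')$, where for $r\in Q$ $$\mathsf{v}'_r=\Delta_N\cap\Bigl(\{x^{-1}zy \;:\; p'\in Q,\ z\in\mathsf{v}_{p'},\ p'\xrightarrow{a\mid y}r \text{ in } E\}\ \cup\ \{x^{-1}y \;:\; (f\colon p\xrightarrow{a\mid y}r)\in E,\ f\prec e\}\Bigr).$$ Let $\mathcal{T}_N$ be the subtransducer of this covering obtained by removing the property of being final from every state $(p,\mathsf{v})$ such that $1\in\mathsf{v}_t$ for some $t\in T$. Then for every $N\ge L\,n^{k+1}$, the transducer $\mathcal{T}_N$ is input-$k$-ambiguous (every $u\in A^*$ is the input of at most $k$ successful computations of $\mathcal{T}_N$) and equivalent to $\mathcal{T}$ (it has the same behaviour). -/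

import Mathlib

/-- A real-time transducer with states `Q` and transitions `E`: each transition `e` reads the letter
`T.letter e` and outputs the word `T.output e`. Distinct elements of `E` may share the same origin,
label and end. Initial and final states carry the empty output word. -/
structure RealTimeTransducer (A B Q E : Type*) where
  src : E → Q
  tgt : E → Q
  letter : E → A
  output : E → List B
  init : Set Q
  final : Set Q

namespace RealTimeTransducer

variable {A B Q E : Type*}

/-- `T.IsPath p c q`: the sequence of transitions `c` is a computation of `T` from `p` to `q`. -/
def IsPath (T : RealTimeTransducer A B Q E) : Q → List E → Q → Prop
  | p, [], q => p = q
  | p, e :: c, q => T.src e = p ∧ T.IsPath (T.tgt e) c q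

/-- The input word of a sequence of transitions. -/
def input (T : RealTimeTransducer A B Q E) (c : List E) : List A :=
  c.map T.letter

/-- The output word of a sequence of transitions. -/
def outputWord (T : RealTimeTransducer A B Q E) (c : List E) : List B :=
  (c.map T.output).flatten

/-- The successful computations of `T`. A computation is given by its first state and its sequence
of transitions (the first state matters only when the sequence is empty). -/
def successful (T : RealTimeTransducer A B Q E) : Set (Q × List E) :=
  {c | c.1 ∈ T.init ∧ ∃ q ∈ T.final, T.IsPath c.1 c.2 q}

/-- The behaviour of `T`: the set of labels of its successful computations. -/
def behaviour (T : RealTimeTransducer A B Q E) : Set (List A × List B) :=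
  {ux | ∃ c ∈ T.successful, T.input c.2 = ux.1 ∧ T.outputWord c.2 = ux.2}

/-- `T` is `k`-valued: every input word has at most `k` images. -/
def IsValued (T : RealTimeTransducer A B Q E) (k : ℕ) : Prop :=
  ∀ u : List A, {x : List B | (u, x) ∈ T.behaviour}.encard ≤ k

/-- `T` is input-`k`-ambiguous: its underlying input automaton is `k`-ambiguous, that is, every
input word is read by at most `k` successful computations. -/
def IsInputAmbiguous (T : RealTimeTransducer A B Q E) (k : ℕ) : Prop :=
  ∀ u : List A, {c : Q × List E | c ∈ T.successful ∧ T.input c.2 = u}.encard ≤ k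

/-- Two transducers are equivalent if they realise the same relation. -/
def Equivalent {Q' E' : Type*} (T : RealTimeTransducer A B Q E)
    (T' : RealTimeTransducer A B Q' E') : Prop :=
  T.behaviour = T'.behaviour

/-- An ordering of the transitions from which computations are ordered lexicographically: a strict
partial order on the transitions in which two distinct transitions are comparable iff they have the
same origin and the same input letter. The initial states are ordered in the same way: they
are regarded as the ends of transitions, with empty label, that leave a hidden initial state. -/
structure TransitionOrder (T : RealTimeTransducer A B Q E) where
  lt : E → E → Prop
  lt_irrefl : ∀ e, ¬ lt e e
  lt_trans : ∀ e f g, lt e f → lt f g → lt e g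
  comparable_iff : ∀ e f, e ≠ f →
    ((lt e f ∨ lt f e) ↔ (T.src e = T.src f ∧ T.letter e = T.letter f))
  initLt : Q → Q → Prop
  initLt_irrefl : ∀ p, ¬ initLt p p
  initLt_trans : ∀ p q r, initLt p q → initLt q r → initLt p r
  initComparable_iff : ∀ p q, p ≠ q →
    ((initLt p q ∨ initLt q p) ↔ (p ∈ T.init ∧ q ∈ T.init))

/-- The image in the free group generated by `B` of a word on `B`. -/
def wordFG (x : List B) : FreeGroup B :=
  (x.map FreeGroup.of).prod

/-- The elements of the free group that are words of length at most `N`, or inverses of such. -/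
def lagSet (B : Type*) (N : ℕ) : Set (FreeGroup B) :=
  {g | ∃ x : List B, x.length ≤ N ∧ (g = wordFG x ∨ g = (wordFG x)⁻¹)}

/-- The states of the bounded lag separation covering: a state `p` of `T` and a vector, indexed by
the states of `T`, of subsets of `lagSet B N`. -/
abbrev LagState (B Q : Type*) (N : ℕ) : Type _ :=
  Q × (Q → Set (lagSet B N))

/-- The vector of the initial state of the covering over the initial state `p` of `T`. It is the
vector of empty sets if `p` is the only initial state. -/
def initVec (T : RealTimeTransducer A B Q E) (O : T.TransitionOrder) (N : ℕ) (p : Q) :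
    Q → Set (lagSet B N) :=
  fun r => {w | O.initLt r p ∧ (w : FreeGroup B) = 1}

/-- The entry in row `p` and column `r` of the matrix of the letter `a`: the outputs of the
transitions from `p` to `r` reading `a`. -/
def mu (T : RealTimeTransducer A B Q E) (a : A) (p r : Q) : Set (List B) :=
  {y | ∃ f : E, T.src f = p ∧ T.letter f = a ∧ T.output f = y ∧ T.tgt f = r}

/-- Reading the transition `e`, with label `a | x`, the vector `v` is replaced by
`x⁻¹ · v · μ(a)` plus the vector of the `x⁻¹ y` for the smaller transitions `f` (with
output `y`), where products are computed in the free group and only the elements that lie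
in `lagSet B N` are kept. -/
def nextVec (T : RealTimeTransducer A B Q E) (O : T.TransitionOrder) (N : ℕ)
    (v : Q → Set (lagSet B N)) (e : E) : Q → Set (lagSet B N) :=
  fun r => {w |
    (∃ p : Q, ∃ z ∈ v p, ∃ y ∈ T.mu (T.letter e) p r,
      (w : FreeGroup B) = (wordFG (T.output e))⁻¹ * (z : FreeGroup B) * wordFG y) ∨
    (∃ f : E, O.lt f e ∧ T.tgt f = r ∧
      (w : FreeGroup B) = (wordFG (T.output e))⁻¹ * wordFG (T.output f))}

/-- The lag separation covering of `T` bounded by `N`. There is one transition leaving `(p, v)` for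
each transition of `T` leaving `p`. -/
def lagCovering (T : RealTimeTransducer A B Q E) (O : T.TransitionOrder) (N : ℕ) :
    RealTimeTransducer A B (LagState B Q N) {se : LagState B Q N × E // T.src se.2 = se.1.1} where
  src se := se.1.1
  tgt se := (T.tgt se.1.2, T.nextVec O N se.1.1.2 se.1.2)
  letter se := T.letter se.1.2
  output se := T.output se.1.2
  init := {s | s.1 ∈ T.init ∧ s.2 = T.initVec O N s.1}
  final := {s | s.1 ∈ T.final}

/-- The subtransducer of the bounded lag separation covering in which a state `(p, v)` is no longer
final if, for some final state `t` of `T`, the entry `v t` contains the empty word. -/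
def lagSelection (T : RealTimeTransducer A B Q E) (O : T.TransitionOrder) (N : ℕ) :
    RealTimeTransducer A B (LagState B Q N) {se : LagState B Q N × E // T.src se.2 = se.1.1} :=
  { T.lagCovering O N with
    final := {s | s ∈ (T.lagCovering O N).final ∧
      ¬ ∃ t ∈ T.final, ∃ w ∈ s.2 t, (w : FreeGroup B) = 1} }

end RealTimeTransducer

/-!
The covering attaches to a computation of the transducer the set of its lags `x⁻¹ y` with respect to
the smaller computations that read the same input, as long as these lags stay in `lagSet B N`
(`exists_of_mem_vecAfter`, `mem_vecAfter_of_mem`, `mem_vecAfter_of_lexLt`). A successful computation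
`c` thus remains successful in the selection unless there is a smaller successful computation with
the same label, all of whose lags with respect to `c` are bounded by `N`. In particular, the least
successful computation with a given label remains, so that the behaviour is preserved
(`equivalent_lagSelection`).

For the ambiguity, suppose that `k + 1` distinct computations that read the same input remain, and
regard them as a single computation of a power of the transducer, on `n ^ (k + 1)` tuples of states.
Let two of them, `i` and `j`, have the same output. If, along this computation, the difference of
the lengths of their outputs were determined by the tuple of states that is reached, as the
difference of values of a potential, then a simple path would bound it by `L * n ^ (k + 1) ≤ N`
(`IsRun.abs_lagLength_le`); the prefixes of a common output being comparable, all lags would be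
bounded, and the larger of the two computations would have been removed. So there is no potential,
which means that some loop of the tuple outputs words of different lengths in `i` and in `j`
(`IsRun.exists_loop`).

Pumping such a loop separates `i` and `j`. Free groups have unique roots, so that two words
`u v ^ m w` and `u' v' ^ m w'` that agree for two values of `m` agree for all of them, with
`v` and `v'` of the same length (`pump_eq_of_eq`). Hence all but finitely many exponents separate
`i` and `j` and keep all other distinct pairs distinct. The existence of a potential depends only on
the set of transitions that occur, which grows under pumping, so the other pairs with the same
output can be separated in turn (`IsRun.exists_injective_outputWord`). This produces an input word
with `k + 1` images, whereas the transducer is `k`-valued.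
-/

namespace RealTimeTransducer

variable {A B Q E : Type*}

/-! ### Words in the free group -/

@[simp]
theorem wordFG_nil : wordFG ([] : List B) = 1 := rfl

@[simp]
theorem wordFG_append (x y : List B) : wordFG (x ++ y) = wordFG x * wordFG y := by
  simp [wordFG]

theorem wordFG_eq_mk (x : List B) : wordFG x = FreeGroup.mk (x.map fun b => (b, true)) := by
  induction x with
  | nil => rfl
  | cons b x ih =>
    rw [← List.singleton_append, wordFG_append, ih]
    simp [wordFG, FreeGroup.of, FreeGroup.mul_mk]

theorem wordFG_injective : Function.Injective (wordFG : List B → FreeGroup B) := by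
  classical
  have hred (x : List B) : (wordFG x).toWord = x.map fun b => (b, true) := by
    rw [wordFG_eq_mk, FreeGroup.toWord_mk]
    refine FreeGroup.IsReduced.reduce_eq ?_
    rw [FreeGroup.IsReduced, List.isChain_map]
    exact List.Pairwise.isChain (List.pairwise_of_forall fun _ _ _ => rfl)
  intro x y h
  have := hred x
  rw [h, hred y] at this
  exact (List.map_injective_iff.2 (fun _ _ h => (Prod.mk.inj h).1) this).symm

/-- The homomorphism that extends the length of words to the free group. -/
noncomputable def lengthHom (B : Type*) : FreeGroup B →* Multiplicative ℤ :=
  FreeGroup.lift fun _ => Multiplicative.ofAdd 1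

theorem lengthHom_wordFG (x : List B) :
    lengthHom B (wordFG x) = Multiplicative.ofAdd (x.length : ℤ) := by
  induction x with
  | nil => rfl
  | cons b x ih =>
    rw [← List.singleton_append, wordFG_append, map_mul, ih]
    simp [wordFG, lengthHom, mul_comm]

theorem one_mem_lagSet (N : ℕ) : (1 : FreeGroup B) ∈ lagSet B N :=
  ⟨[], by simp, Or.inl rfl⟩

/-- The lag between two prefixes of the same word is a word or the inverse of a word, and its
length is the difference of their lengths. -/
theorem lag_mem_lagSet {x y z : List B} {N : ℕ} (hx : x <+: z) (hy : y <+: z)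
    (h : |(x.length : ℤ) - y.length| ≤ N) : (wordFG x)⁻¹ * wordFG y ∈ lagSet B N := by
  rw [abs_le] at h
  rcases List.prefix_or_prefix_of_prefix hx hy with ⟨t, rfl⟩ | ⟨t, rfl⟩
  · refine ⟨t, ?_, Or.inl (by simp)⟩
    simp at h; omega
  · refine ⟨t, ?_, Or.inr (by simp)⟩
    simp at h; omega

/-- If two sequences of words `u v ^ m w` agree for two exponents, then they agree for all
exponents and the iterated factors have the same length. In the free group, roots are unique, so
that the iterated factors are conjugate by the lag `u⁻¹ u'`. -/
theorem pump_eq_of_eq {u v w u' v' w' : List B} {m n : ℕ} (hmn : m < n)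
    (hm : u ++ (List.replicate m v).flatten ++ w = u' ++ (List.replicate m v').flatten ++ w')
    (hn : u ++ (List.replicate n v).flatten ++ w = u' ++ (List.replicate n v').flatten ++ w') :
    v.length = v'.length ∧ ∀ l : ℕ,
      u ++ (List.replicate l v).flatten ++ w = u' ++ (List.replicate l v').flatten ++ w' := by
  have hpow (l : ℕ) (v : List B) : wordFG (List.replicate l v).flatten = wordFG v ^ l := by
    induction l with
    | zero => rfl
    | succ l ih => rw [List.replicate_succ, List.flatten_cons, wordFG_append, ih, pow_succ']
  have hm' := congrArg wordFG hm
  have hn' := congrArg wordFG hn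
  simp only [wordFG_append, hpow] at hm' hn'
  set g := (wordFG u)⁻¹ * wordFG u' with hg
  obtain ⟨d, rfl⟩ := Nat.exists_eq_add_of_lt hmn
  have hu' : wordFG u' = wordFG u * g := by simp [hg]
  rw [hu'] at hm' hn'
  have hm1 : wordFG v ^ m * wordFG w = g * wordFG v' ^ m * wordFG w' := by
    simpa only [mul_assoc, mul_right_inj] using hm'
  have hn1 : wordFG v ^ (m + d + 1) * wordFG w = g * wordFG v' ^ (m + d + 1) * wordFG w' := by
    simpa only [mul_assoc, mul_right_inj] using hn'
  have hroot : wordFG v ^ (d + 1) = (g * wordFG v' * g⁻¹) ^ (d + 1) := by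
    rw [conj_pow]
    have e : m + d + 1 = (d + 1) + m := by omega
    rw [e, pow_add _ (d + 1), pow_add _ (d + 1), mul_assoc, hm1] at hn1
    have h2 : wordFG v ^ (d + 1) * g * (wordFG v' ^ m * wordFG w') =
        g * wordFG v' ^ (d + 1) * (wordFG v' ^ m * wordFG w') := by
      simpa only [mul_assoc] using hn1
    rw [eq_mul_inv_iff_mul_eq]
    exact mul_right_cancel h2
  have hv : wordFG v = g * wordFG v' * g⁻¹ := pow_left_injective (Nat.succ_ne_zero d) hroot
  have hw : wordFG w = g * wordFG w' := by
    rw [hv, conj_pow] at hm1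
    have h3 : g * wordFG v' ^ m * (g⁻¹ * wordFG w) = g * wordFG v' ^ m * wordFG w' := by
      simpa only [mul_assoc] using hm1
    rw [← mul_left_cancel h3]; simp
  constructor
  · have := congrArg (lengthHom B) hv
    rw [map_mul, map_mul, map_inv, mul_comm (lengthHom B g), mul_inv_cancel_right,
      lengthHom_wordFG, lengthHom_wordFG] at this
    exact_mod_cast Multiplicative.ofAdd.injective this
  · intro l
    apply wordFG_injective
    simp only [wordFG_append, hpow]
    rw [hv, hw, hu', conj_pow]
    group

/-! ### Computations and their lexicographic order -/

@[simp]
theorem outputWord_nil (T : RealTimeTransducer A B Q E) : T.outputWord [] = [] := rfl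

@[simp]
theorem outputWord_cons (T : RealTimeTransducer A B Q E) (e : E) (c : List E) :
    T.outputWord (e :: c) = T.output e ++ T.outputWord c := rfl

@[simp]
theorem outputWord_append (T : RealTimeTransducer A B Q E) (c d : List E) :
    T.outputWord (c ++ d) = T.outputWord c ++ T.outputWord d := by
  simp [outputWord]

theorem outputWord_replicate (T : RealTimeTransducer A B Q E) (m : ℕ) (c : List E) :
    T.outputWord (List.replicate m c).flatten = (List.replicate m (T.outputWord c)).flatten := by
  induction m with
  | zero => rfl
  | succ m ih => simp [List.replicate_succ, ih]

theorem outputWord_take_prefix (T : RealTimeTransducer A B Q E) (c : List E) (s : ℕ) :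
    T.outputWord (c.take s) <+: T.outputWord c :=
  ⟨T.outputWord (c.drop s), by rw [← outputWord_append, List.take_append_drop]⟩

theorem isPath_append (T : RealTimeTransducer A B Q E) {p q : Q} {c d : List E} :
    T.IsPath p (c ++ d) q ↔ ∃ r, T.IsPath p c r ∧ T.IsPath r d q := by
  induction c generalizing p with
  | nil => simp [IsPath]
  | cons e c ih => simp [IsPath, ih, and_assoc]

theorem IsPath.end_unique {T : RealTimeTransducer A B Q E} {p q q' : Q} {c : List E}
    (h : T.IsPath p c q) (h' : T.IsPath p c q') : q = q' := by
  induction c generalizing p with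
  | nil => exact h.symm.trans h'
  | cons e c ih => exact ih h.2 h'.2

/-- The strict lexicographic order on sequences of transitions of the same length. -/
def lexLt {T : RealTimeTransducer A B Q E} (O : T.TransitionOrder) : List E → List E → Prop
  | f :: d, e :: c => O.lt f e ∨ (f = e ∧ lexLt O d c)
  | _, _ => False

/-- The lexicographic order on computations, given by an initial state and a sequence of
transitions. -/
def compLt {T : RealTimeTransducer A B Q E} (O : T.TransitionOrder) (d c : Q × List E) : Prop :=
  O.initLt d.1 c.1 ∨ (d.1 = c.1 ∧ lexLt O d.2 c.2)

section Order

variable {T : RealTimeTransducer A B Q E} (O : T.TransitionOrder)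

theorem lexLt_irrefl (c : List E) : ¬ lexLt O c c := by
  induction c with
  | nil => simp [lexLt]
  | cons e c ih => simp [lexLt, ih, O.lt_irrefl]

theorem lexLt_trans {a b c : List E} (hab : lexLt O a b) (hbc : lexLt O b c) : lexLt O a c := by
  induction a generalizing b c with
  | nil => simp [lexLt] at hab
  | cons f a ih =>
    cases b with
    | nil => simp [lexLt] at hab
    | cons g b =>
      cases c with
      | nil => simp [lexLt] at hbc
      | cons e c =>
        rcases hab with h1 | ⟨rfl, h1⟩ <;> rcases hbc with h2 | ⟨rfl, h2⟩
        · exact Or.inl (O.lt_trans _ _ _ h1 h2)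
        · exact Or.inl h1
        · exact Or.inl h2
        · exact Or.inr ⟨rfl, ih h1 h2⟩

theorem lexLt_or_lexLt {p q q' : Q} {c d : List E} (hc : T.IsPath p c q) (hd : T.IsPath p d q')
    (hin : T.input c = T.input d) (hne : c ≠ d) : lexLt O c d ∨ lexLt O d c := by
  induction c generalizing p d with
  | nil =>
    cases d with
    | nil => exact absurd rfl hne
    | cons => simp [input] at hin
  | cons e c ih =>
    cases d with
    | nil => simp [input] at hin
    | cons f d =>
      simp only [input, List.map_cons, List.cons.injEq] at hin
      by_cases hef : e = f
      · subst hef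
        rcases ih hc.2 hd.2 hin.2 (fun h => hne (by rw [h])) with h | h
        · exact Or.inl (Or.inr ⟨rfl, h⟩)
        · exact Or.inr (Or.inr ⟨rfl, h⟩)
      · rcases (O.comparable_iff e f hef).2 ⟨hc.1.trans hd.1.symm, hin.1⟩ with h | h
        · exact Or.inl (Or.inl h)
        · exact Or.inr (Or.inl h)

theorem compLt_or_compLt {q q' : Q} {c d : Q × List E} (hci : c.1 ∈ T.init) (hdi : d.1 ∈ T.init)
    (hc : T.IsPath c.1 c.2 q) (hd : T.IsPath d.1 d.2 q') (hin : T.input c.2 = T.input d.2)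
    (hne : c ≠ d) : compLt O c d ∨ compLt O d c := by
  by_cases h : c.1 = d.1
  · rw [← h] at hd
    rcases lexLt_or_lexLt O hc hd hin (fun h' => hne (Prod.ext h h')) with h' | h'
    · exact Or.inl (Or.inr ⟨h, h'⟩)
    · exact Or.inr (Or.inr ⟨h.symm, h'⟩)
  · exact ((O.initComparable_iff _ _ h).2 ⟨hci, hdi⟩).imp Or.inl Or.inl

instance : IsStrictOrder (Q × List E) (compLt O) where
  irrefl c h := h.elim (O.initLt_irrefl _) fun h => lexLt_irrefl O _ h.2
  trans := by
    rintro ⟨p, a⟩ ⟨q, b⟩ ⟨r, c⟩ h1 h2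
    simp only [compLt] at *
    rcases h1 with h1 | ⟨rfl, h1⟩ <;> rcases h2 with h2 | ⟨rfl, h2⟩
    · exact Or.inl (O.initLt_trans _ _ _ h1 h2)
    · exact Or.inl h1
    · exact Or.inl h2
    · exact Or.inr ⟨rfl, lexLt_trans O h1 h2⟩

/-! ### The vector reached by the covering -/

/-- The vector that the covering reaches from the vector `v` along the lift of the sequence of
transitions `c`. -/
def vecAfter (O : T.TransitionOrder) (N : ℕ) (v : Q → Set (lagSet B N)) (c : List E) :
    Q → Set (lagSet B N) :=
  c.foldl (T.nextVec O N) v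

variable {N : ℕ}

/-- Every element of the vector reached along `c` is the lag of a computation with the same input:
one that extends an element of the vector at the start, or one that is smaller than `c`. -/
theorem exists_of_mem_vecAfter {v : Q → Set (lagSet B N)} {p q r : Q} {c : List E}
    (hc : T.IsPath p c q) {w : lagSet B N} (hw : w ∈ vecAfter O N v c r) :
    (∃ p', ∃ z ∈ v p', ∃ d, T.IsPath p' d r ∧ T.input d = T.input c ∧
      (w : FreeGroup B) = (wordFG (T.outputWord c))⁻¹ * z * wordFG (T.outputWord d)) ∨
    (∃ d, T.IsPath p d r ∧ T.input d = T.input c ∧ lexLt O d c ∧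
      (w : FreeGroup B) = (wordFG (T.outputWord c))⁻¹ * wordFG (T.outputWord d)) := by
  induction c generalizing v p with
  | nil => exact Or.inl ⟨r, w, hw, [], rfl, rfl, by simp⟩
  | cons e c ih =>
    rcases ih hc.2 hw with ⟨p', z, hz, d, hd, hin, hwd⟩ | ⟨d, hd, hin, hlt, hwd⟩
    · rcases hz with ⟨p₀, z₀, hz₀, y, ⟨f, hfs, hfl, rfl, rfl⟩, hzz⟩ | ⟨f, hfe, rfl, hzz⟩
      · refine Or.inl ⟨p₀, z₀, hz₀, f :: d, ⟨hfs, hd⟩, ?_, ?_⟩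
        · simp only [input, List.map_cons] at hin ⊢
          rw [hin, hfl]
        · rw [hwd, hzz]
          simp [mul_assoc]
      · have hne : f ≠ e := fun h => O.lt_irrefl e (h ▸ hfe)
        obtain ⟨hs, hl⟩ := (O.comparable_iff f e hne).1 (Or.inl hfe)
        refine Or.inr ⟨f :: d, ⟨hs.trans hc.1, hd⟩, ?_, Or.inl hfe, ?_⟩
        · simp only [input, List.map_cons] at hin ⊢
          rw [hin, hl]
        · rw [hwd, hzz]
          simp [mul_assoc]
    · refine Or.inr ⟨e :: d, ⟨hc.1, hd⟩, ?_, Or.inr ⟨rfl, hlt⟩, ?_⟩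
      · simp only [input, List.map_cons] at hin ⊢
        rw [hin]
      · rw [hwd]
        simp [mul_assoc]

/-- An element of the vector is carried along a computation with the same input as long as the lags
stay within the bound. -/
theorem mem_vecAfter_of_mem {v : Q → Set (lagSet B N)} {p r : Q} {c d : List E} {z : FreeGroup B}
    (hz : ∃ w ∈ v p, (w : FreeGroup B) = z) (hd : T.IsPath p d r) (hin : T.input d = T.input c)
    (hlag : ∀ s, (wordFG (T.outputWord (c.take s)))⁻¹ * z *
      wordFG (T.outputWord (d.take s)) ∈ lagSet B N) :
    ∃ w ∈ vecAfter O N v c r,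
      (w : FreeGroup B) = (wordFG (T.outputWord c))⁻¹ * z * wordFG (T.outputWord d) := by
  induction c generalizing v p d z with
  | nil =>
    cases d with
    | nil =>
      cases hd
      simpa [vecAfter] using hz
    | cons => simp [input] at hin
  | cons e c ih =>
    cases d with
    | nil => simp [input] at hin
    | cons f d =>
      simp only [input, List.map_cons, List.cons.injEq] at hin
      obtain ⟨w₀, hw₀, rfl⟩ := hz
      have h1 := hlag 1
      simp only [List.take_succ_cons, List.take_zero, outputWord_cons, outputWord_nil,
        List.append_nil] at h1
      obtain ⟨w, hw, hwe⟩ := ih (v := T.nextVec O N v e) (p := T.tgt f) (d := d)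
        (z := (wordFG (T.output e))⁻¹ * w₀ * wordFG (T.output f))
        ⟨⟨_, h1⟩, Or.inl ⟨p, w₀, hw₀, _, ⟨f, hd.1, hin.1, rfl, rfl⟩, rfl⟩, rfl⟩ hd.2 hin.2
        (fun s => by simpa [mul_assoc] using hlag (s + 1))
      exact ⟨w, hw, by rw [hwe]; simp [mul_assoc]⟩

/-- The lag of a smaller computation from the same state is recorded as long as the lags stay
within the bound. -/
theorem mem_vecAfter_of_lexLt {v : Q → Set (lagSet B N)} {p r : Q} {c d : List E}
    (hlt : lexLt O d c) (hd : T.IsPath p d r) (hin : T.input d = T.input c)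
    (hlag : ∀ s, (wordFG (T.outputWord (c.take s)))⁻¹ *
      wordFG (T.outputWord (d.take s)) ∈ lagSet B N) :
    ∃ w ∈ vecAfter O N v c r,
      (w : FreeGroup B) = (wordFG (T.outputWord c))⁻¹ * wordFG (T.outputWord d) := by
  induction c generalizing v p d with
  | nil => cases d <;> simp [lexLt] at hlt
  | cons e c ih =>
    cases d with
    | nil => simp [lexLt] at hlt
    | cons f d =>
      simp only [input, List.map_cons, List.cons.injEq] at hin
      rcases hlt with hfe | ⟨rfl, hlt⟩
      · have h1 := hlag 1
        simp only [List.take_succ_cons, List.take_zero, outputWord_cons, outputWord_nil,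
          List.append_nil] at h1
        obtain ⟨w, hw, hwe⟩ := mem_vecAfter_of_mem O (v := T.nextVec O N v e) (p := T.tgt f)
          (c := c) (d := d) (r := r) (z := (wordFG (T.output e))⁻¹ * wordFG (T.output f))
          ⟨⟨_, h1⟩, Or.inr ⟨f, hfe, rfl, rfl⟩, rfl⟩ hd.2 hin.2
          (fun s => by simpa [mul_assoc] using hlag (s + 1))
        exact ⟨w, hw, by rw [hwe]; simp [mul_assoc]⟩
      · obtain ⟨w, hw, hwe⟩ := ih (v := T.nextVec O N v f) hlt hd.2 hin.2
          (fun s => by simpa [mul_assoc] using hlag (s + 1))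
        exact ⟨w, hw, by rw [hwe]; simp [mul_assoc]⟩

/-- A computation survives if the covering does not witness a smaller successful computation with
the same label. -/
def Survives (O : T.TransitionOrder) (N : ℕ) (c : Q × List E) : Prop :=
  ¬ ∃ t ∈ T.final, ∃ w ∈ vecAfter O N (T.initVec O N c.1) c.2 t, (w : FreeGroup B) = 1

/-- If `d` is smaller than `c`, with the same label, then `c` does not survive, unless some lag
between the two exceeds the bound. -/
theorem not_survives_of_compLt {c d : Q × List E} (hlt : compLt O d c) (hd : d ∈ T.successful)
    (hin : T.input d.2 = T.input c.2) (hout : T.outputWord d.2 = T.outputWord c.2)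
    (hlag : ∀ s, (wordFG (T.outputWord (c.2.take s)))⁻¹ *
      wordFG (T.outputWord (d.2.take s)) ∈ lagSet B N) : ¬ Survives O N c := by
  obtain ⟨-, t, ht, hdt⟩ := hd
  refine not_not_intro ⟨t, ht, ?_⟩
  rcases hlt with h | ⟨h, hlt⟩
  · obtain ⟨w, hw, hwe⟩ := mem_vecAfter_of_mem O (v := T.initVec O N c.1) (z := 1) (c := c.2)
      ⟨⟨1, one_mem_lagSet N⟩, ⟨h, rfl⟩, rfl⟩ hdt hin (by simpa using hlag)
    exact ⟨w, hw, by rw [hwe, hout]; simp⟩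
  · obtain ⟨w, hw, hwe⟩ := mem_vecAfter_of_lexLt O (v := T.initVec O N c.1) hlt hdt hin hlag
    exact ⟨w, hw, by rw [hwe, hout]; simp⟩

/-- A computation that does not survive is preceded by one with the same label. -/
theorem exists_compLt_of_not_survives {c : Q × List E} (hc : c ∈ T.successful)
    (h : ¬ Survives O N c) : ∃ d ∈ T.successful, compLt O d c ∧ T.input d.2 = T.input c.2 ∧
      T.outputWord d.2 = T.outputWord c.2 := by
  obtain ⟨hci, q, -, hcq⟩ := hc
  obtain ⟨t, ht, w, hw, hw1⟩ := not_not.1 h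
  rcases exists_of_mem_vecAfter O hcq hw with ⟨p, z, ⟨hpc, hz⟩, d, hd, hin, hwe⟩ |
    ⟨d, hd, hin, hlt, hwe⟩
  · have hne : p ≠ c.1 := fun h => O.initLt_irrefl _ (h ▸ hpc)
    refine ⟨(p, d), ⟨((O.initComparable_iff _ _ hne).1 (Or.inl hpc)).1, t, ht, hd⟩,
      Or.inl hpc, hin, wordFG_injective ?_⟩
    rw [hw1, hz, mul_one, eq_comm, inv_mul_eq_one] at hwe
    exact hwe.symm
  · refine ⟨(c.1, d), ⟨hci, t, ht, hd⟩, Or.inr ⟨rfl, hlt⟩, hin, wordFG_injective ?_⟩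
    rw [hw1, eq_comm, inv_mul_eq_one] at hwe
    exact hwe.symm

/-! ### Computations of the covering -/

/-- The transitions of the covering. -/
abbrev LagTransition (T : RealTimeTransducer A B Q E) (N : ℕ) : Type _ :=
  {se : LagState B Q N × E // T.src se.2 = se.1.1}

/-- The sequence of transitions of `T` under a sequence of transitions of the covering. -/
def project (C : List (LagTransition T N)) : List E :=
  C.map fun se => se.1.2

theorem project_of_isPath {s t : LagState B Q N} {C : List (LagTransition T N)}
    (h : (T.lagSelection O N).IsPath s C t) :
    T.IsPath s.1 (project C) t.1 ∧ t.2 = vecAfter O N s.2 (project C) := by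
  induction C generalizing s with
  | nil =>
    cases h
    exact ⟨rfl, rfl⟩
  | cons a C ih =>
    obtain ⟨rfl, h⟩ := h
    exact ⟨⟨a.2, (ih h).1⟩, (ih h).2⟩

theorem project_injective {s t t' : LagState B Q N} {C C' : List (LagTransition T N)}
    (h : (T.lagSelection O N).IsPath s C t) (h' : (T.lagSelection O N).IsPath s C' t')
    (hC : project C = project C') : C = C' := by
  induction C generalizing s C' with
  | nil => exact (List.map_eq_nil_iff.1 hC.symm).symm
  | cons a C ih =>
    cases C' with
    | nil => simp [project] at hC
    | cons a' C' =>
      simp only [project, List.map_cons, List.cons.injEq] at hC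
      obtain rfl : a = a' := Subtype.ext (Prod.ext (h.1.trans h'.1.symm) hC.1)
      rw [ih h.2 h'.2 hC.2]

theorem exists_lift {p q : Q} {c : List E} (h : T.IsPath p c q) (v : Q → Set (lagSet B N)) :
    ∃ C : List (LagTransition T N), project C = c ∧
      (T.lagSelection O N).IsPath (p, v) C (q, vecAfter O N v c) := by
  induction c generalizing p v with
  | nil =>
    cases h
    exact ⟨[], rfl, rfl⟩
  | cons e c ih =>
    obtain ⟨C, hC, hp⟩ := ih h.2 (T.nextVec O N v e)
    exact ⟨⟨((p, v), e), h.1⟩ :: C, congrArg (e :: ·) hC, rfl, hp⟩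

theorem input_lagSelection (C : List (LagTransition T N)) :
    (T.lagSelection O N).input C = T.input (project C) := by
  simp [input, project, lagSelection, lagCovering]

theorem outputWord_lagSelection (C : List (LagTransition T N)) :
    (T.lagSelection O N).outputWord C = T.outputWord (project C) := by
  simp [outputWord, project, lagSelection, lagCovering, Function.comp_def]

theorem project_mem_successful {s : LagState B Q N} {C : List (LagTransition T N)}
    (h : (s, C) ∈ (T.lagSelection O N).successful) :
    (s.1, project C) ∈ T.successful ∧ Survives O N (s.1, project C) := by
  obtain ⟨⟨hi, hv⟩, t, ⟨htf, hts⟩, hp⟩ := h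
  obtain ⟨h1, h2⟩ := project_of_isPath O hp
  rw [h2, hv] at hts
  exact ⟨⟨hi, t.1, htf, h1⟩, hts⟩

theorem exists_lift_of_survives {c : Q × List E} (hc : c ∈ T.successful) (hs : Survives O N c) :
    ∃ C : List (LagTransition T N), project C = c.2 ∧
      ((c.1, T.initVec O N c.1), C) ∈ (T.lagSelection O N).successful := by
  obtain ⟨hi, q, hq, hp⟩ := hc
  obtain ⟨C, hC, hp'⟩ := exists_lift O hp (T.initVec O N c.1)
  exact ⟨C, hC, ⟨hi, rfl⟩, (q, vecAfter O N (T.initVec O N c.1) c.2), ⟨hq, hs⟩, hp'⟩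

/-- The least successful computation with a given label survives, for any bound. -/
theorem equivalent_lagSelection [Finite Q] [Finite E] (N : ℕ) :
    (T.lagSelection O N).Equivalent T := by
  ext ⟨u, x⟩
  constructor
  · rintro ⟨⟨s, C⟩, hC, rfl, rfl⟩
    exact ⟨_, (project_mem_successful O hC).1, (input_lagSelection O C).symm,
      (outputWord_lagSelection O C).symm⟩
  · rintro ⟨c₀, hc₀, hu, hx⟩
    let S : Set (Q × List E) :=
      {c | c ∈ T.successful ∧ T.input c.2 = u ∧ T.outputWord c.2 = x}
    have hfin : S.Finite := by
      refine ((Set.finite_univ (α := Q)).prod (List.finite_length_eq E u.length)).subset ?_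
      rintro c ⟨-, h, -⟩
      exact ⟨trivial, by simp [← h, input]⟩
    have hwf : S.WellFoundedOn (compLt O) := hfin.wellFoundedOn
    obtain ⟨⟨c, hcs, hcu, hcx⟩, -, hmin⟩ :=
      WellFounded.has_min hwf Set.univ ⟨⟨c₀, hc₀, hu, hx⟩, trivial⟩
    have hsurv : Survives O N c := by
      by_contra hns
      obtain ⟨d, hd, hlt, hdu, hdx⟩ := exists_compLt_of_not_survives O hcs hns
      exact hmin ⟨d, hd, hdu.trans hcu, hdx.trans hcx⟩ trivial hlt
    obtain ⟨C, hC, hsucc⟩ := exists_lift_of_survives O hcs hsurv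
    exact ⟨_, hsucc, by rw [input_lagSelection, hC, hcu],
      by rw [outputWord_lagSelection, hC, hcx]⟩

end Order

/-! ### Tuples of computations -/

section Tuples

variable {ι : Type*} {T : RealTimeTransducer A B Q E}

/-- `IsRun T σ C τ`: the word `C` of tuples of transitions is a computation of a power of `T`, that
is, a tuple of computations of `T` from `σ i` to `τ i` which read the same input. -/
structure IsRun (T : RealTimeTransducer A B Q E) (σ : ι → Q) (C : List (ι → E)) (τ : ι → Q) :
    Prop where
  isPath : ∀ i, T.IsPath (σ i) (C.map (· i)) (τ i)
  letter_eq : ∀ e ∈ C, ∀ i j, T.letter (e i) = T.letter (e j)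

theorem isRun_nil {σ : ι → Q} : IsRun T σ [] σ := ⟨fun _ => rfl, by simp⟩

theorem isRun_append {σ τ : ι → Q} {C D : List (ι → E)} :
    IsRun T σ (C ++ D) τ ↔ ∃ ρ, IsRun T σ C ρ ∧ IsRun T ρ D τ := by
  constructor
  · rintro ⟨h, hl⟩
    simp only [List.map_append, isPath_append] at h
    choose ρ hρ using h
    exact ⟨ρ, ⟨fun i => (hρ i).1, fun e he => hl e (by simp [he])⟩,
      ⟨fun i => (hρ i).2, fun e he => hl e (by simp [he])⟩⟩
  · rintro ⟨ρ, h1, h2⟩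
    refine ⟨fun i => ?_, fun e he => ?_⟩
    · rw [List.map_append, isPath_append]
      exact ⟨ρ i, h1.isPath i, h2.isPath i⟩
    · exact (List.mem_append.1 he).elim (h1.letter_eq e) (h2.letter_eq e)

theorem isRun_cons {σ τ : ι → Q} {e : ι → E} {C : List (ι → E)} :
    IsRun T σ (e :: C) τ ↔ (∀ i j, T.letter (e i) = T.letter (e j)) ∧ T.src ∘ e = σ ∧
      IsRun T (T.tgt ∘ e) C τ := by
  constructor
  · rintro ⟨h, hl⟩
    exact ⟨hl e (by simp), funext fun i => (h i).1,
      fun i => (h i).2, fun f hf => hl f (by simp [hf])⟩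
  · rintro ⟨hl, rfl, h⟩
    exact ⟨fun i => ⟨rfl, h.isPath i⟩, by simpa using ⟨hl, h.letter_eq⟩⟩

theorem IsRun.end_unique {σ τ τ' : ι → Q} {C : List (ι → E)} (h : IsRun T σ C τ)
    (h' : IsRun T σ C τ') : τ = τ' :=
  funext fun i => (h.isPath i).end_unique (h'.isPath i)

theorem IsRun.replicate {ρ : ι → Q} {β : List (ι → E)} (h : IsRun T ρ β ρ) (m : ℕ) :
    IsRun T ρ (List.replicate m β).flatten ρ := by
  induction m with
  | zero => exact isRun_nil
  | succ m ih => exact isRun_append.2 ⟨ρ, h, ih⟩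

theorem IsRun.input_eq {σ τ : ι → Q} {C : List (ι → E)} (h : IsRun T σ C τ) (i j : ι) :
    T.input (C.map (· i)) = T.input (C.map (· j)) := by
  simp only [input, List.map_map]
  exact List.map_congr_left fun e he => h.letter_eq e he i j

/-- Computations that read the same word can be combined into a computation of a power of `T`. -/
theorem exists_isRun {σ τ : ι → Q} {c : ι → List E} {u : List A}
    (hc : ∀ i, T.IsPath (σ i) (c i) (τ i)) (hu : ∀ i, T.input (c i) = u) :
    ∃ C : List (ι → E), (∀ i, C.map (· i) = c i) ∧ IsRun T σ C τ := by
  have hlen (i : ι) : (c i).length = u.length := by simp [← hu i, input]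
  have hC (i : ι) : (List.ofFn fun (s : Fin u.length) (i : ι) =>
      (c i)[s.1]'((hlen i).symm ▸ s.2)).map (· i) = c i :=
    List.ext_getElem (by simp [hlen]) (by simp)
  refine ⟨_, hC, fun i => (hC i).symm ▸ hc i, fun e he i j => ?_⟩
  have := (congrArg T.input (hC i)).trans ((hu i).trans ((hu j).symm.trans
    (congrArg T.input (hC j)).symm))
  simp only [input, List.map_map] at this
  exact List.map_inj_left.1 this e he

/-- The difference of the lengths of the outputs of the components `i` and `j`. -/
def lagLength (T : RealTimeTransducer A B Q E) (i j : ι) (C : List (ι → E)) : ℤ :=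
  (T.outputWord (C.map (· i))).length - (T.outputWord (C.map (· j))).length

theorem lagLength_append (i j : ι) (C D : List (ι → E)) :
    lagLength T i j (C ++ D) = lagLength T i j C + lagLength T i j D := by
  simp [lagLength]
  ring

/-- The transitions of `C` admit a potential for the pair `(i, j)`: along them, the difference of
the lengths of the outputs is determined by the tuples of states. -/
def HasPotential (T : RealTimeTransducer A B Q E) (i j : ι) (C : List (ι → E)) : Prop :=
  ∃ φ : (ι → Q) → ℤ, ∀ e ∈ C, φ (T.tgt ∘ e) - φ (T.src ∘ e) = lagLength T i j [e]

theorem HasPotential.mono {i j : ι} {C D : List (ι → E)} (hCD : C ⊆ D) (h : HasPotential T i j D) :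
    HasPotential T i j C :=
  h.imp fun _ hφ e he => hφ e (hCD he)

/-- If there is no potential, then some loop increases the lag: otherwise, the lag of the prefixes
that lead to a tuple of states would be a potential. -/
theorem IsRun.exists_loop {i j : ι} {σ τ : ι → Q} {C : List (ι → E)} (hC : IsRun T σ C τ)
    (h : ¬ HasPotential T i j C) : ∃ α β γ ρ, C = α ++ β ++ γ ∧ IsRun T σ α ρ ∧ IsRun T ρ β ρ ∧
      IsRun T ρ γ τ ∧ lagLength T i j β ≠ 0 := by
  classical
  by_contra! hloop
  have hle {α α' : List (ι → E)} {ρ : ι → Q} (h1 : α <+: α') (h2 : α' <+: C)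
      (h3 : IsRun T σ α ρ) (h4 : IsRun T σ α' ρ) : lagLength T i j α = lagLength T i j α' := by
    obtain ⟨β, rfl⟩ := h1
    obtain ⟨γ, rfl⟩ := h2
    obtain ⟨ρ₁, h5, h6⟩ := isRun_append.1 hC
    obtain rfl := h4.end_unique h5
    obtain ⟨ρ₂, h7, h8⟩ := isRun_append.1 h4
    obtain rfl := h3.end_unique h7
    rw [lagLength_append, hloop α β γ _ rfl h3 h8 h6, add_zero]
  have heq {α α' : List (ι → E)} {ρ : ι → Q} (h1 : α <+: C) (h2 : α' <+: C)
      (h3 : IsRun T σ α ρ) (h4 : IsRun T σ α' ρ) : lagLength T i j α = lagLength T i j α' :=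
    (List.prefix_or_prefix_of_prefix h1 h2).elim (fun h => hle h h2 h3 h4)
      (fun h => (hle h h1 h4 h3).symm)
  let φ : (ι → Q) → ℤ := fun ρ =>
    if h : ∃ α, α <+: C ∧ IsRun T σ α ρ then lagLength T i j h.choose else 0
  have hφ {α : List (ι → E)} {ρ : ι → Q} (h1 : α <+: C) (h2 : IsRun T σ α ρ) :
      φ ρ = lagLength T i j α := by
    have hex : ∃ α, α <+: C ∧ IsRun T σ α ρ := ⟨α, h1, h2⟩
    simp only [φ, dif_pos hex]
    exact heq hex.choose_spec.1 h1 hex.choose_spec.2 h2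
  refine h ⟨φ, fun e he => ?_⟩
  obtain ⟨α, γ, rfl⟩ := List.append_of_mem he
  obtain ⟨ρ, h1, h2⟩ := isRun_append.1 hC
  obtain ⟨hl, rfl, -⟩ := isRun_cons.1 h2
  have h3 : IsRun T σ (α ++ [e]) (T.tgt ∘ e) :=
    isRun_append.2 ⟨_, h1, isRun_cons.2 ⟨hl, rfl, isRun_nil⟩⟩
  rw [hφ ⟨_, rfl⟩ h1, hφ ⟨γ, by simp⟩ h3, lagLength_append]
  ring

/-- A function on the vertices of a finite graph that varies by at most `L` along each edge varies by
at most `L` times the number of vertices on a connected component, since a simple path joins any two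
vertices. -/
theorem abs_sub_le_of_reachable {V : Type*} [Fintype V] (G : SimpleGraph V) (φ : V → ℤ) (L : ℕ)
    (hφ : ∀ a b, G.Adj a b → |φ b - φ a| ≤ L) {a b : V} (h : G.Reachable a b) :
    |φ b - φ a| ≤ L * Fintype.card V := by
  have hwalk {a b : V} (p : G.Walk a b) : |φ b - φ a| ≤ L * p.length := by
    induction p with
    | nil => simp
    | cons hadj p ih =>
      rename_i x y z
      have := abs_sub_le (φ z) (φ y) (φ x)
      have := hφ _ _ hadj
      rw [SimpleGraph.Walk.length_cons]
      push_cast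
      linarith
  obtain ⟨p, hp⟩ := h.exists_isPath
  refine (hwalk p).trans ?_
  have := hp.length_lt
  gcongr

/-- A potential bounds the lags. -/
theorem IsRun.abs_lagLength_le [Fintype ι] [DecidableEq ι] [Fintype Q] {L : ℕ} {i j : ι}
    {σ τ : ι → Q} {C : List (ι → E)} (hL : ∀ e : E, (T.output e).length ≤ L) (hC : IsRun T σ C τ)
    (h : HasPotential T i j C) : |lagLength T i j C| ≤ L * Fintype.card Q ^ Fintype.card ι := by
  obtain ⟨φ, hφ⟩ := h
  let G : SimpleGraph (ι → Q) :=
    { Adj := fun a b => a ≠ b ∧ |φ b - φ a| ≤ L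
      symm := ⟨fun a b h => ⟨h.1.symm, by rw [abs_sub_comm]; exact h.2⟩⟩
      loopless := ⟨fun a h => h.1 rfl⟩ }
  have hreach : G.Reachable σ τ ∧ lagLength T i j C = φ τ - φ σ := by
    induction C generalizing σ with
    | nil =>
      obtain rfl := hC.end_unique isRun_nil
      exact ⟨SimpleGraph.Reachable.refl _, by simp [lagLength]⟩
    | cons e C ih =>
      obtain ⟨-, rfl, h2⟩ := isRun_cons.1 hC
      obtain ⟨h3, h4⟩ := ih h2 fun f hf => hφ f (by simp [hf])
      have he := hφ e (by simp)
      refine ⟨SimpleGraph.Reachable.trans ?_ h3, ?_⟩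
      · by_cases heq : T.src ∘ e = T.tgt ∘ e
        · rw [heq]
        · refine SimpleGraph.Adj.reachable ⟨heq, ?_⟩
          rw [he, abs_le]
          have h5 := hL (e i)
          have h6 := hL (e j)
          simp only [lagLength, List.map_cons, List.map_nil, outputWord_cons, outputWord_nil,
            List.append_nil]
          omega
      · rw [← List.singleton_append, lagLength_append, h4, ← he]
        ring
  rw [hreach.2]
  simpa using abs_sub_le_of_reachable G φ L (fun a b h => h.2) hreach.1

/-- Pumping makes the outputs of a tuple of computations pairwise distinct, if every pair with the
same output has no potential. -/
theorem IsRun.exists_injective_outputWord [Finite ι] {σ τ : ι → Q} {C : List (ι → E)}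
    (hC : IsRun T σ C τ)
    (h : ∀ i j, i ≠ j → T.outputWord (C.map (· i)) = T.outputWord (C.map (· j)) →
      ¬ HasPotential T i j C) :
    ∃ D, IsRun T σ D τ ∧ Function.Injective fun i => T.outputWord (D.map (· i)) := by
  let eqPairs (C : List (ι → E)) : Set (ι × ι) :=
    {p | p.1 ≠ p.2 ∧ T.outputWord (C.map (· p.1)) = T.outputWord (C.map (· p.2))}
  induction hn : (eqPairs C).ncard using Nat.strong_induction_on generalizing C with
  | _ n ih =>
  subst hn
  by_cases hempty : ∃ p, p ∈ eqPairs C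
  swap
  · refine ⟨C, hC, fun i j hij => ?_⟩
    by_contra hne
    exact hempty ⟨(i, j), hne, hij⟩
  obtain ⟨⟨i₀, j₀⟩, hne₀, heq₀⟩ := hempty
  obtain ⟨α, β, γ, ρ, rfl, hα, hβ, hγ, hlag⟩ := hC.exists_loop (h i₀ j₀ hne₀ heq₀)
  let pump (m : ℕ) : List (ι → E) := α ++ (List.replicate m β).flatten ++ γ
  have hpump1 : pump 1 = α ++ β ++ γ := by simp [pump]
  have hout (m : ℕ) (i : ι) : T.outputWord ((pump m).map (· i)) =
      T.outputWord (α.map (· i)) ++ (List.replicate m (T.outputWord (β.map (· i)))).flatten ++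
        T.outputWord (γ.map (· i)) := by
    simp only [pump, List.map_append, outputWord_append, List.map_flatten, List.map_replicate,
      outputWord_replicate]
  -- Two exponents for which a pair of outputs agrees force agreement for all exponents.
  have hall {i j : ι} {m n : ℕ} (hmn : m ≠ n) (hm : (i, j) ∈ eqPairs (pump m))
      (hn : (i, j) ∈ eqPairs (pump n)) : lagLength T i j β = 0 ∧ (i, j) ∈ eqPairs (pump 1) := by
    have key {m n : ℕ} (hlt : m < n) (hm : (i, j) ∈ eqPairs (pump m))
        (hn : (i, j) ∈ eqPairs (pump n)) :
        lagLength T i j β = 0 ∧ (i, j) ∈ eqPairs (pump 1) := by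
      obtain ⟨hm0, hm⟩ := hm
      obtain ⟨-, hn⟩ := hn
      simp only [hout] at hm hn
      obtain ⟨h1, h2⟩ := pump_eq_of_eq hlt hm hn
      refine ⟨by simp [lagLength, h1], hm0, ?_⟩
      simp only [hout]
      exact h2 1
    exact hmn.lt_or_gt.elim (fun h => key h hm hn) (fun h => key h hn hm)
  -- Hence all but finitely many exponents separate `i₀` and `j₀` and keep separate the pairs that
  -- were already so.
  have hbad : (⋃ p : ι × ι, {m : ℕ | p ∈ eqPairs (pump m) ∧
      (p ∉ eqPairs (pump 1) ∨ p = (i₀, j₀))}).Finite := by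
    refine Set.finite_iUnion fun ⟨i, j⟩ => Set.Subsingleton.finite ?_
    rintro m ⟨hm, hp⟩ n ⟨hn, -⟩
    by_contra hmn
    obtain ⟨h1, h2⟩ := hall hmn hm hn
    rcases hp with hp | hp
    · exact hp h2
    · obtain ⟨rfl, rfl⟩ := Prod.mk.inj hp
      exact hlag h1
  obtain ⟨m, hm1, hm⟩ := (Set.Ici_infinite 1).exists_notMem_finite hbad
  simp only [Set.mem_iUnion, Set.mem_ofPred_eq, not_exists, not_and, not_or, not_not] at hm
  have hsub : eqPairs (pump m) ⊆ eqPairs (pump 1) := fun p hp => (hm p hp).1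
  have hmem₀ : (i₀, j₀) ∈ eqPairs (pump 1) := by rw [hpump1]; exact ⟨hne₀, heq₀⟩
  have hcard : (eqPairs (pump m)).ncard < (eqPairs (pump 1)).ncard :=
    Set.ncard_lt_ncard (LE.le.ssubset_of_mem_notMem hsub hmem₀ fun h => (hm _ h).2 rfl)
  rw [hpump1] at hcard hsub
  refine ih _ hcard (isRun_append.2 ⟨ρ, isRun_append.2 ⟨ρ, hα, hβ.replicate m⟩, hγ⟩) ?_ rfl
  intro i j hij hijm hpot
  -- Since `m ≥ 1`, no transition is lost, so that a potential for the pumped tuple is one for the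
  -- original tuple.
  refine h i j hij (hsub ⟨hij, hijm⟩ : (i, j) ∈ _).2 (hpot.mono ?_)
  have hβm : β ⊆ (List.replicate m β).flatten := fun e he =>
    List.mem_flatten.2 ⟨β, List.mem_replicate.2 ⟨Nat.one_le_iff_ne_zero.1 hm1, rfl⟩, he⟩
  intro e he
  simp only [List.mem_append] at he ⊢
  exact he.imp_left (Or.imp_right fun h => hβm h)

end Tuples

/-! ### Ambiguity of the selection -/

/-- More than `k` computations that survive could be pumped to computations with the same input and
pairwise distinct outputs. -/
theorem isInputAmbiguous_lagSelection [Fintype Q] {T : RealTimeTransducer A B Q E}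
    (O : T.TransitionOrder) {k L N : ℕ} (hL : ∀ e : E, (T.output e).length ≤ L)
    (hk : T.IsValued k) (hN : L * Fintype.card Q ^ (k + 1) ≤ N) :
    (T.lagSelection O N).IsInputAmbiguous k := by
  classical
  intro u
  by_contra! hlt
  obtain ⟨S, hS, hcard⟩ := Set.exists_subset_encard_eq (Order.add_one_le_of_lt hlt)
  have hfin : S.Finite := Set.finite_of_encard_eq_coe (k := k + 1) (by exact_mod_cast hcard)
  have : Fintype S := hfin.fintype
  have hcardS : Fintype.card S = k + 1 := by
    rw [← Set.coe_fintypeCard] at hcard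
    exact_mod_cast hcard
  -- The computations of `T` under the given ones.
  let c (i : S) : Q × List E := (i.1.1.1, project i.1.2)
  have hsucc (i : S) : c i ∈ T.successful := (project_mem_successful O (hS i.2).1).1
  have hsurv (i : S) : Survives O N (c i) := (project_mem_successful O (hS i.2).1).2
  have hin (i : S) : T.input (c i).2 = u := (input_lagSelection O _).symm.trans (hS i.2).2
  have hinj : Function.Injective c := by
    rintro ⟨⟨⟨p, v⟩, C⟩, hC⟩ ⟨⟨⟨p', v'⟩, C'⟩, hC'⟩ h
    obtain ⟨h1, h2⟩ := Prod.mk.inj h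
    obtain rfl : p = p' := h1
    obtain ⟨⟨⟨-, hv⟩, t, -, hp⟩, -⟩ := hS hC
    obtain ⟨⟨⟨-, hv'⟩, t', -, hp'⟩, -⟩ := hS hC'
    obtain rfl : v = v' := hv.trans hv'.symm
    obtain rfl := project_injective O hp hp' h2
    rfl
  choose hinit τ hτ hpath using hsucc
  obtain ⟨C, hC, hrun⟩ := exists_isRun hpath hin
  -- A pair with the same output and a potential has bounded lags, so that the larger computation
  -- of the two does not survive.
  have hpot (i j : S) (hij : i ≠ j)
      (heq : T.outputWord (C.map (· i)) = T.outputWord (C.map (· j))) :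
      ¬ HasPotential T i j C := by
    intro hp
    have hbound (s : ℕ) : |lagLength T i j (C.take s)| ≤ N := by
      obtain ⟨ρ, h1, -⟩ := isRun_append.1 ((List.take_append_drop s C).symm ▸ hrun)
      refine (h1.abs_lagLength_le hL (hp.mono (List.take_subset s C))).trans ?_
      rw [hcardS]
      exact_mod_cast hN
    have hlag (s : ℕ) : |((T.outputWord ((c i).2.take s)).length : ℤ) -
        (T.outputWord ((c j).2.take s)).length| ≤ N := by
      simpa only [lagLength, List.map_take, hC] using hbound s
    rw [hC, hC] at heq
    have hpre (s : ℕ) : T.outputWord ((c i).2.take s) <+: T.outputWord (c j).2 :=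
      heq ▸ outputWord_take_prefix T _ s
    have hpre' (s : ℕ) : T.outputWord ((c j).2.take s) <+: T.outputWord (c j).2 :=
      outputWord_take_prefix T _ s
    rcases compLt_or_compLt O (hinit i) (hinit j) (hpath i) (hpath j) ((hin i).trans (hin j).symm)
      (hinj.ne hij) with h | h
    · refine not_survives_of_compLt O h ⟨hinit i, τ i, hτ i, hpath i⟩ ((hin i).trans (hin j).symm)
        heq (fun s => lag_mem_lagSet (hpre' s) (hpre s) ?_) (hsurv j)
      rw [abs_sub_comm]
      exact hlag s
    · exact not_survives_of_compLt O h ⟨hinit j, τ j, hτ j, hpath j⟩ ((hin j).trans (hin i).symm)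
        heq.symm (fun s => lag_mem_lagSet (hpre s) (hpre' s) (hlag s)) (hsurv i)
  obtain ⟨D, hD, hDinj⟩ := hrun.exists_injective_outputWord hpot
  obtain ⟨i₀⟩ : Nonempty S := Fintype.card_pos_iff.1 (by omega)
  have hsub : Set.range (fun i => T.outputWord (D.map (· i))) ⊆
      {x | (T.input (D.map (· i₀)), x) ∈ T.behaviour} := by
    rintro _ ⟨i, rfl⟩
    exact ⟨((c i).1, D.map (· i)), ⟨hinit i, τ i, hτ i, hD.isPath i⟩, hD.input_eq i i₀, rfl⟩
  have hle := hDinj.encard_range.trans ((Set.encard_le_encard hsub).trans (hk _))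
  rw [ENat.card_eq_coe_fintype_card, hcardS] at hle
  exact absurd (Nat.cast_le.1 hle) (by omega)

end RealTimeTransducer

theorem propositionp {A B Q E : Type*} [Fintype Q] [Fintype E]
    (T : RealTimeTransducer A B Q E) (O : T.TransitionOrder) (k L N : ℕ)
    (hL : ∀ e : E, (T.output e).length ≤ L)
    (hk : T.IsValued k)
    (hN : L * Fintype.card Q ^ (k + 1) ≤ N) :
    (T.lagSelection O N).IsInputAmbiguous k ∧ (T.lagSelection O N).Equivalent T :=
  ⟨RealTimeTransducer.isInputAmbiguous_lagSelection O hL hk hN,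
    RealTimeTransducer.equivalent_lagSelection O N⟩
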